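/- Let $X_1,\dots,X_n$ be independent real random variables with a common continuous distribution function, and let $\mathcal F_i=\sigma(X_1,\dots,X_i)$. A feasible policy $\pi_n$ decides sequentially, for each $i=1,\dots,n$, whether to select $X_i$, the event that $X_i$ is selected belonging to $\mathcal F_i$, and in such a way that the selected subsequence is always unimodal: if $\tau_1<\tau_2<\cdots<\tau_k$ are the indices of the selected observations and $k\ge 1$, then $$X_{\tau_1}\le X_{\tau_2}\le\cdots\le X_{\tau_t}\ge X_{\tau_{t+1}}\ge\cdots\ge X_{\tau_k}\quad\text{for some }1\le t\le k .$$ Let $\Pi(n)$ be the set of feasible policies and let $U^o_n(\pi_n)$ be the number $k$ of observations that $\pi_n$ selects. **Theorem (Expected Length of Optimal Unimodal Subsequences).** For each $n\ge 1$ there is a policy $\pi_n^*\in\Pi(n)$ such that $$\mathbb E[U^o_n(\pi^*_n)]=\sup_{\pi_n\in\Pi(n)}\mathbb E[U^o_n(\pi_n)].$$ There is an absolute constant $C$ such that for every $n\ge 1$ every such optimal policy satisfies (with $\pi=3.14\ldots$ in the constant) $$2n^{1/2}-4(\pi/6)^{1/2}n^{1/4}-C<\mathbb E[U^o_n(\pi^*_n)]<2n^{1/2}.$$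 Consequently, for an infinite sequence of such random variables and optimal policies $\pi^*_n$ for the first $n$ of them, $$\mathbb E[U^o_n(\pi^*_n)]\sim 2n^{1/2}\quad\text{as }n\to\infty .$$ -/

import Mathlib

open MeasureTheory ProbabilityTheory

namespace UnimodalSelection

/-- The random variables `X i` are independent with a common continuous distribution function. -/
structure IsIIDContinuous {Ω ι : Type*} [MeasurableSpace Ω] (P : Measure Ω)
    (X : ι → Ω → ℝ) : Prop where
  measurable : ∀ i, Measurable (X i)
  indep : iIndepFun X P
  common_cdf : ∃ F : ℝ → ℝ, Continuous F ∧ ∀ i x, P.real {ω | X i ω ≤ x} = F x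

/-- The values `x i`, `i ∈ S`, taken in the order of their indices, form a unimodal sequence:
(weakly) increasing up to some turning place `t ∈ S`, and (weakly) decreasing from there on.
Either piece may consist of the single element `x t`; the empty sequence is unimodal. -/
def IsUnimodalOn {n : ℕ} (x : Fin n → ℝ) (S : Set (Fin n)) : Prop :=
  S = ∅ ∨ ∃ t ∈ S, MonotoneOn x {i | i ∈ S ∧ i ≤ t} ∧ AntitoneOn x {i | i ∈ S ∧ t ≤ i}

/-- The σ-field generated by the observations up to and including the one with index `i`. -/
@[reducible] def observedUpTo {Ω : Type*} {n : ℕ} (X : Fin n → Ω → ℝ) (i : Fin n) : MeasurableSpace Ω :=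
  ⨆ j : Fin n, ⨆ _ : j ≤ i, MeasurableSpace.comap (X j) inferInstance

/-- A feasible policy for the sequential selection of a unimodal subsequence of the `n`
observations `X 0, …, X (n - 1)`. The event that the observation with index `i` is selected
is decided by the observations up to and including that one, and the selected
subsequence is always unimodal. -/
structure FeasiblePolicy {Ω : Type*} {n : ℕ} (X : Fin n → Ω → ℝ) where
  /-- the event that the observation with index `i` is selected -/
  select : Fin n → Set Ω
  nonanticipating : ∀ i, MeasurableSet[observedUpTo X i] (select i)
  unimodal : ∀ ω, IsUnimodalOn (fun i => X i ω) {i | ω ∈ select i}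

namespace FeasiblePolicy

variable {Ω : Type*} {n : ℕ} {X : Fin n → Ω → ℝ}

/-- The length of the unimodal subsequence that is selected by the policy. -/
noncomputable def length (π : FeasiblePolicy X) (ω : Ω) : ℕ :=
  Set.ncard {i : Fin n | ω ∈ π.select i}

/-- The expected length of the selected subsequence. -/
noncomputable def expectedLength [MeasurableSpace Ω] (P : Measure Ω)
    (π : FeasiblePolicy X) : ℝ :=
  ∫ ω, (π.length ω : ℝ) ∂P

/-- The policy attains the supremum of the expected lengths over all feasible policies. -/
def IsOptimal [MeasurableSpace Ω] (P : Measure Ω) (π : FeasiblePolicy X) : Prop :=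
  IsLUB (Set.range fun ρ : FeasiblePolicy X => ρ.expectedLength P) (π.expectedLength P)

end FeasiblePolicy

end UnimodalSelection

/-! The common distribution function makes the observations uniform on [0,1]. Folding the falling
phase onto [1,2] then turns a unimodal selection into a motion to the right through [0,2]. The
position is the only state, so the optimum obeys the Bellman recursion `optimalValue`: the number of
selections so far plus the value of the current position is a supermartingale under every policy
(`expectedLength_le`), and a martingale under the rule that follows the recursion
(`exists_expectedLength_eq`). Hence every optimal policy has expectation `optimalValue n 0`, and
only the recursion remains to be estimated.

Upper bound (`optimalValue_lt_linear`): if distance is priced at 1/l per unit, one offer earns at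
most ∫₀ˡ (1 - c/l) dc = l/2, so (2 - r)/l + k l/2 dominates the value. The choice l = 2/√n gives
2√n.

Lower bound (`minorant_le_optimalValue_rising`): accepting only displacements of at most l, which
average l/2, yields about min(lk, 2b/l) selections from k offers and distance b. A smooth quadratic
stand-in for this minimum satisfies the recursion as an inequality, and the fluctuations cost order
n^(1/4). -/

namespace UnimodalSelection

/-! ### The Bellman recursion and its regularity -/

/-- The state of a selection process is a position `r ∈ [0, 2]`: a rising phase with last selected
value `s` is at position `s`, and a falling phase with last selected value `s` is at `2 - s`.
Selecting the value `y` moves the position to `turn r y`. -/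
noncomputable def turn (r y : ℝ) : ℝ := if r ≤ y then y else 2 - y

/-- The value of acting optimally at position `r` when the value `y` is offered and `w` is the
value of the positions afterwards. -/
noncomputable def offerValue (w : ℝ → ℝ) (r y : ℝ) : ℝ :=
  if r ≤ 2 - y then max (w r) (1 + w (turn r y)) else w r

/-- The maximal expected number of further selections at a position when a given number of
uniformly distributed observations remain. -/
noncomputable def optimalValue : ℕ → ℝ → ℝ
  | 0 => fun _ => 0
  | k + 1 => fun r => ∫ y in (0 : ℝ)..1, offerValue (optimalValue k) r y

lemma turn_mono {r s y : ℝ} (hy : y ≤ 1) (h : r ≤ s) : turn r y ≤ turn s y := by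
  unfold turn; split_ifs <;> linarith

lemma le_offerValue (w : ℝ → ℝ) (r y : ℝ) : w r ≤ offerValue w r y := by
  unfold offerValue; split_ifs
  · exact le_max_left _ _
  · exact le_rfl

lemma add_one_le_offerValue (w : ℝ → ℝ) {r y : ℝ} (h : r ≤ 2 - y) :
    1 + w (turn r y) ≤ offerValue w r y := by
  rw [offerValue, if_pos h]; exact le_max_right _ _

/-- A smaller position can imitate a larger one: whatever is feasible at `s` is feasible at `r`, and
leads no further right. -/
lemma offerValue_antitone {w : ℝ → ℝ} (hw : Antitone w) {y : ℝ} (hy : y ≤ 1) :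
    Antitone fun r => offerValue w r y := by
  intro r s h
  simp only
  by_cases hs : s ≤ 2 - y
  · rw [offerValue, if_pos hs, offerValue, if_pos (h.trans hs)]
    have := hw (turn_mono hy h)
    exact max_le_max (hw h) (by linarith)
  · rw [offerValue, if_neg hs]
    exact (hw h).trans (le_offerValue w r y)

lemma offerValue_le {w : ℝ → ℝ} {c : ℝ} (hw : ∀ r, w r ≤ c) (r y : ℝ) :
    offerValue w r y ≤ 1 + c := by
  have h1 := hw r
  have h2 := hw (turn r y)
  unfold offerValue; split_ifs
  · exact max_le (by linarith) (by linarith)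
  · linarith

lemma measurable_turn : Measurable fun p : ℝ × ℝ => turn p.1 p.2 := by
  unfold turn
  exact Measurable.ite (measurableSet_le measurable_fst measurable_snd) measurable_snd
    (measurable_const.sub measurable_snd)

lemma measurable_offerValue {w : ℝ → ℝ} (hw : Measurable w) :
    Measurable fun p : ℝ × ℝ => offerValue w p.1 p.2 := by
  unfold offerValue
  exact Measurable.ite (measurableSet_le measurable_fst (measurable_const.sub measurable_snd))
    ((hw.comp measurable_fst).max (measurable_const.add (hw.comp measurable_turn)))
    (hw.comp measurable_fst)

lemma intervalIntegrable_offerValue {w : ℝ → ℝ} (hw : Measurable w) {c : ℝ} (h0 : ∀ r, 0 ≤ w r)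
    (hc : ∀ r, w r ≤ c) (r a b : ℝ) : IntervalIntegrable (offerValue w r) volume a b := by
  have hm : Measurable (offerValue w r) :=
    (measurable_offerValue hw).comp (measurable_const.prodMk measurable_id)
  refine (intervalIntegrable_const (c := 1 + c) (μ := volume) (a := a) (b := b)).mono_fun
    hm.aestronglyMeasurable (Filter.Eventually.of_forall fun y => ?_)
  have h1 := (h0 r).trans (le_offerValue w r y)
  have h2 := offerValue_le hc r y
  simp only [Real.norm_of_nonneg h1]
  exact h2.trans (le_abs_self _)

/-- Monotonicity and bounds share one induction because they supply the measurability and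
boundedness that make the next integral meaningful. -/
lemma optimalValue_regular (k : ℕ) :
    Antitone (optimalValue k) ∧ ∀ r, 0 ≤ optimalValue k r ∧ optimalValue k r ≤ k := by
  induction k with
  | zero => exact ⟨fun _ _ _ => le_rfl, fun r => by simp [optimalValue]⟩
  | succ k ih =>
    obtain ⟨ha, hb⟩ := ih
    have hi := fun r => intervalIntegrable_offerValue ha.measurable (fun r => (hb r).1)
      (fun r => (hb r).2) r 0 1
    refine ⟨fun r s h => ?_, fun r => ⟨?_, ?_⟩⟩
    · exact intervalIntegral.integral_mono_on zero_le_one (hi s) (hi r)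
        fun y hy => offerValue_antitone ha hy.2 h
    · exact intervalIntegral.integral_nonneg zero_le_one
        fun y _ => (hb r).1.trans (le_offerValue _ r y)
    · have := intervalIntegral.integral_mono_on zero_le_one (hi r)
        (intervalIntegrable_const (c := 1 + (k : ℝ)))
        fun y _ => offerValue_le (fun r => (hb r).2) r y
      simp only [intervalIntegral.integral_const, sub_zero, smul_eq_mul, one_mul] at this
      simp only [optimalValue]
      push_cast
      linarith

lemma optimalValue_antitone (k : ℕ) : Antitone (optimalValue k) := (optimalValue_regular k).1

lemma optimalValue_nonneg (k : ℕ) (r : ℝ) : 0 ≤ optimalValue k r := ((optimalValue_regular k).2 r).1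

lemma optimalValue_le (k : ℕ) (r : ℝ) : optimalValue k r ≤ k := ((optimalValue_regular k).2 r).2

lemma measurable_optimalValue (k : ℕ) : Measurable (optimalValue k) :=
  (optimalValue_antitone k).measurable

lemma intervalIntegrable_offerValue_optimalValue (k : ℕ) (r a b : ℝ) :
    IntervalIntegrable (offerValue (optimalValue k) r) volume a b :=
  intervalIntegrable_offerValue (measurable_optimalValue k) (optimalValue_nonneg k)
    (optimalValue_le k) r a b

/-! ### Upper bound -/

lemma integral_lt_of_lt_on_Ioo {f g : ℝ → ℝ} {a b : ℝ} (hab : a < b)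
    (hf : IntervalIntegrable f volume a b) (hg : IntervalIntegrable g volume a b)
    (h : ∀ x ∈ Set.Ioo a b, f x < g x) : ∫ x in a..b, f x < ∫ x in a..b, g x := by
  have := intervalIntegral.intervalIntegral_pos_of_pos_on (hg.sub hf)
    (fun x hx => by simpa using h x hx) hab
  rw [intervalIntegral.integral_sub hg hf] at this
  linarith

lemma continuous_hinge (l : ℝ) : Continuous fun c : ℝ => max 0 (1 - c / l) := by fun_prop

lemma integral_hinge_le {l b : ℝ} (hl : 0 < l) (hb : 0 ≤ b) :
    ∫ c in (0 : ℝ)..b, max 0 (1 - c / l) ≤ l / 2 := by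
  have aux : ∀ a : ℝ, 0 ≤ a → a ≤ l → ∫ c in (0 : ℝ)..a, max 0 (1 - c / l) ≤ l / 2 := by
    intro a ha hal
    have h1 : ∫ c in (0 : ℝ)..a, max 0 (1 - c / l) = ∫ c in (0 : ℝ)..a, (1 - c / l) := by
      refine intervalIntegral.integral_congr fun c hc => ?_
      rw [Set.uIcc_of_le ha] at hc
      exact max_eq_right (by have := (div_le_one hl).2 (hc.2.trans hal); linarith)
    rw [h1, intervalIntegral.integral_sub (by simp) (by apply Continuous.intervalIntegrable; fun_prop),
      intervalIntegral.integral_div]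
    simp only [intervalIntegral.integral_const, integral_id, smul_eq_mul]
    rw [← sub_nonneg]
    have : l / 2 - ((a - 0) * 1 - (a ^ 2 - 0 ^ 2) / 2 / l) = (l - a) ^ 2 / (2 * l) := by
      field_simp; ring
    rw [this]; positivity
  rcases le_total b l with h | h
  · exact aux b hb h
  · rw [← intervalIntegral.integral_add_adjacent_intervals (b := l)
      ((continuous_hinge l).intervalIntegrable _ _) ((continuous_hinge l).intervalIntegrable _ _)]
    have h2 : ∫ c in l..b, max 0 (1 - c / l) = ∫ c in l..b, (0 : ℝ) := by
      refine intervalIntegral.integral_congr fun c hc => ?_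
      rw [Set.uIcc_of_le h] at hc
      exact max_eq_left (by have := (one_le_div hl).2 hc.1; linarith)
    rw [h2]
    simpa using aux l hl.le le_rfl

/-- A selection at displacement `c` earns 1 and spends `c / l` of the linear bound, so an offer
improves on it by at most the hinge function of `c`. Different offers reach different displacements,
with density at most 1, and the hinge integrates to at most `l / 2`. -/
lemma optimalValue_lt_linear {l : ℝ} (hl : 0 < l) (k : ℕ) :
    ∀ r, 0 ≤ r → r < 2 → optimalValue k r < (2 - r) / l + k * (l / 2) := by
  induction k with
  | zero =>
    intro r _ hr
    simp only [optimalValue, Nat.cast_zero, zero_mul, add_zero]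
    exact div_pos (by linarith) hl
  | succ k ih =>
    intro r h0 h2
    set L : ℝ → ℝ := fun r => (2 - r) / l + k * (l / 2) with hL
    set φ : ℝ → ℝ := fun c => max 0 (1 - c / l) with hφ
    have hφc : Continuous φ := continuous_hinge l
    have hφi : ∀ b, 0 ≤ b → ∫ c in (0 : ℝ)..b, φ c ≤ l / 2 := fun b hb => integral_hinge_le hl hb
    have hφa : Antitone φ := fun x y hxy =>
      max_le_max le_rfl (by have := div_le_div_of_nonneg_right hxy hl.le; linarith)
    have hi := intervalIntegrable_offerValue_optimalValue k r
    have hr := ih r h0 h2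
    have up : ∀ y, 0 < y → y < 1 →
        offerValue (optimalValue k) r y < L r + φ (turn r y - r) := by
      intro y hy0 hy1
      have hz : 0 ≤ turn r y ∧ turn r y < 2 := by
        unfold turn; split_ifs <;> constructor <;> linarith
      have h3 := ih _ hz.1 hz.2
      have h4 : L r + (1 - (turn r y - r) / l) = 1 + L (turn r y) := by
        simp only [hL]; ring
      have h5 : 0 ≤ φ (turn r y - r) := le_max_left _ _
      have h6 : 1 - (turn r y - r) / l ≤ φ (turn r y - r) := le_max_right _ _
      have h7 : L (turn r y) = (2 - turn r y) / l + k * (l / 2) := rfl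
      have h8 : L r = (2 - r) / l + k * (l / 2) := rfl
      unfold offerValue; split_ifs
      · exact max_lt (by linarith) (by linarith)
      · linarith
    have hgoal : (2 - r) / l + ((k + 1 : ℕ) : ℝ) * (l / 2) = L r + l / 2 := by
      simp only [hL]; push_cast; ring
    rw [hgoal]
    simp only [optimalValue]
    rcases lt_or_ge r 1 with h1 | h1
    · rw [← intervalIntegral.integral_add_adjacent_intervals (hi 0 r) (hi r 1)]
      have A : ∫ y in (0 : ℝ)..r, offerValue (optimalValue k) r y
          ≤ ∫ y in (0 : ℝ)..r, (L r + φ (1 - y)) := by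
        refine intervalIntegral.integral_mono_on_of_le_Ioo h0 (hi 0 r)
          (Continuous.intervalIntegrable (by fun_prop) _ _) fun y hy => ?_
        have := up y hy.1 (hy.2.trans h1)
        rw [turn, if_neg (by linarith [hy.2])] at this
        -- Since `r < 1`, turning down at `y` costs at least `1 - y`. These lengths fill [1 - r, 1],
        -- just beyond the lengths [0, 1 - r] of the rising offers.
        have h9 : φ (2 - y - r) ≤ φ (1 - y) := hφa (by linarith)
        linarith
      have B : ∫ y in r..1, offerValue (optimalValue k) r y
          < ∫ y in r..1, (L r + φ (y - r)) := by
        refine integral_lt_of_lt_on_Ioo h1 (hi r 1)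
          (Continuous.intervalIntegrable (by fun_prop) _ _) fun y hy => ?_
        have := up y (h0.trans_lt hy.1) hy.2
        rwa [turn, if_pos hy.1.le] at this
      rw [intervalIntegral.integral_add (by simp)
        (Continuous.intervalIntegrable (by fun_prop) _ _),
        intervalIntegral.integral_comp_sub_left φ 1] at A
      rw [intervalIntegral.integral_add (by simp)
        (Continuous.intervalIntegrable (by fun_prop) _ _),
        intervalIntegral.integral_comp_sub_right φ r] at B
      have C := intervalIntegral.integral_add_adjacent_intervals
        (hφc.intervalIntegrable (μ := volume) 0 (1 - r)) (hφc.intervalIntegrable (1 - r) 1)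
      have D := hφi 1 zero_le_one
      simp only [intervalIntegral.integral_const, smul_eq_mul, sub_self, sub_zero] at A B C
      linarith
    · rw [← intervalIntegral.integral_add_adjacent_intervals (hi 0 (2 - r)) (hi (2 - r) 1)]
      -- Strictness comes from this interval, nonempty as `r < 2`; the infeasible offers above `2 -
      -- r` may form a null set.
      have A : ∫ y in (0 : ℝ)..(2 - r), offerValue (optimalValue k) r y
          < ∫ y in (0 : ℝ)..(2 - r), (L r + φ (2 - r - y)) := by
        refine integral_lt_of_lt_on_Ioo (by linarith) (hi 0 (2 - r))
          (Continuous.intervalIntegrable (by fun_prop) _ _) fun y hy => ?_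
        have := up y hy.1 (by linarith [hy.2])
        rw [turn, if_neg (by linarith [hy.2])] at this
        rwa [sub_right_comm] at this
      have B : ∫ y in (2 - r)..1, offerValue (optimalValue k) r y
          ≤ ∫ y in (2 - r)..1, L r := by
        refine intervalIntegral.integral_mono_on_of_le_Ioo (by linarith) (hi _ 1)
          (by simp) fun y hy => ?_
        rw [offerValue, if_neg (by linarith [hy.1])]
        exact hr.le
      rw [intervalIntegral.integral_add (by simp)
        (Continuous.intervalIntegrable (by fun_prop) _ _),
        intervalIntegral.integral_comp_sub_left φ (2 - r)] at A
      have D := hφi (2 - r) (by linarith)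
      simp only [intervalIntegral.integral_const, smul_eq_mul, sub_self, sub_zero] at A B
      linarith

lemma optimalValue_lt_two_mul_sqrt {n : ℕ} (hn : 1 ≤ n) :
    optimalValue n 0 < 2 * √(n : ℝ) := by
  have hs : 0 < √(n : ℝ) := Real.sqrt_pos.2 (by exact_mod_cast hn)
  -- This `l` minimizes 2/l + n l/2.
  have h := optimalValue_lt_linear (l := 2 / √(n : ℝ)) (by positivity) n 0 le_rfl (by norm_num)
  have e : (2 - 0) / (2 / √(n : ℝ)) + n * (2 / √(n : ℝ) / 2) = 2 * √(n : ℝ) := by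
    have : (n : ℝ) = √(n : ℝ) ^ 2 := (Real.sq_sqrt (by positivity)).symm
    nth_rewrite 2 [this]
    field_simp
    ring
  linarith

/-! ### Lower bound -/

/-- A quadratic minorant of the smaller one of `l * k` and `2 * b / l`, which are the numbers of
selections that `k` observations and a distance `b` to go allow when offers are accepted within
a window of length `l`. -/
noncomputable def minorant (l e k b : ℝ) : ℝ :=
  l * k / 2 + b / l - e / 4 - (l * k - 2 * b / l) ^ 2 / (4 * e) - k * l / (3 * e)

/-- With z = lk - 2b/l, the minimum is the mean of both numbers minus |z|/2, and |z|/2 ≤ e/4 +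
z²/(4e). The difference from `2 * b / l` is thus a completed square plus the fluctuation term. -/
lemma minorant_le {l e k b : ℝ} (hl : 0 < l) (he : 0 < e) (hk : 0 ≤ k) :
    minorant l e k b ≤ 2 * b / l := by
  have h1 : l * k / 2 + b / l - e / 4 - (l * k - 2 * b / l) ^ 2 / (4 * e)
      = 2 * b / l - ((l * k - 2 * b / l) - e) ^ 2 / (4 * e) := by
    field_simp; ring
  have h2 : 0 ≤ ((l * k - 2 * b / l) - e) ^ 2 / (4 * e) := by positivity
  have h3 : 0 ≤ k * l / (3 * e) := by positivity
  unfold minorant; linarith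

lemma minorant_zero_le {l e b : ℝ} (hl : 0 < l) (he : 0 < e) : minorant l e 0 b ≤ 0 := by
  have h1 : minorant l e 0 b = - ((2 * b / l) - e) ^ 2 / (4 * e) := by
    unfold minorant; field_simp; ring
  rw [h1]
  have h2 : 0 ≤ ((2 * b / l) - e) ^ 2 / (4 * e) := by positivity
  rw [neg_div]; linarith

/-- One offer lowers z = lk - 2b/l by l and, if accepted at displacement c, raises it by 2c/l, so
its mean is unchanged. The variance 4l/3 - l² enters divided by 4e: the term kl/(3e) pays for 4l/3,
and l²/(4e) is slack. -/
lemma minorant_succ_le {l e k b : ℝ} (hl : 0 < l) (he : 0 < e) :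
    minorant l e (k + 1) b ≤
      minorant l e k b + ∫ c in (0 : ℝ)..l, (1 + minorant l e k (b - c) - minorant l e k b) := by
  set z := l * k - 2 * b / l with hz
  have hint : ∀ c, 1 + minorant l e k (b - c) - minorant l e k b
      = 1 - (1 / l + z / (e * l)) * c - (1 / (e * l ^ 2)) * c ^ 2 := by
    intro c; simp only [minorant, hz]; field_simp; ring
  simp only [hint]
  rw [intervalIntegral.integral_sub (Continuous.intervalIntegrable (by fun_prop) _ _)
    (Continuous.intervalIntegrable (by fun_prop) _ _),
    intervalIntegral.integral_sub (Continuous.intervalIntegrable (by fun_prop) _ _)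
    (Continuous.intervalIntegrable (by fun_prop) _ _)]
  rw [intervalIntegral.integral_const_mul _ fun x => x]
  simp only [intervalIntegral.integral_const_mul, intervalIntegral.integral_const, integral_id,
    integral_pow, smul_eq_mul]
  have key : minorant l e (k + 1) b = minorant l e k b +
      (l / 2 - (2 * z * l + l ^ 2) / (4 * e) - l / (3 * e)) := by
    simp only [minorant, hz]; field_simp; ring
  rw [key]
  have h2 : 0 ≤ l ^ 2 / (4 * e) := by positivity
  have h3 : (l - 0) * 1 - (1 / l + z / (e * l)) * ((l ^ 2 - 0 ^ 2) / 2) -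
      1 / (e * l ^ 2) * ((l ^ (2 + 1) - 0 ^ (2 + 1)) / ((2 : ℕ) + 1))
      = l / 2 - (2 * z * l + l ^ 2) / (4 * e) - l / (3 * e) + l ^ 2 / (4 * e) := by
    push_cast; field_simp; ring
  rw [h3]; linarith

lemma continuous_minorant (l e k : ℝ) : Continuous (minorant l e k) := by
  unfold minorant; fun_prop

/-- Accepting all offers from the window `[a, a + l]`. -/
lemma window_le_optimalValue_succ {k : ℕ} {r a l : ℝ} (hl : 0 < l) (ha : 0 ≤ a) (hal : a + l ≤ 1)
    {g : ℝ → ℝ} (hg : Continuous g) {c : ℝ} (hc : c ≤ optimalValue k r)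
    (h : ∀ y ∈ Set.Icc a (a + l), g y ≤ offerValue (optimalValue k) r y) :
    c + ∫ y in a..(a + l), (g y - c) ≤ optimalValue (k + 1) r := by
  have hi := intervalIntegrable_offerValue_optimalValue k r
  have A : ∫ y in (0 : ℝ)..a, c ≤ ∫ y in (0 : ℝ)..a, offerValue (optimalValue k) r y :=
    intervalIntegral.integral_mono_on ha (by simp) (hi _ _)
      fun y _ => hc.trans (le_offerValue _ r y)
  have B : ∫ y in a..(a + l), g y ≤ ∫ y in a..(a + l), offerValue (optimalValue k) r y :=
    intervalIntegral.integral_mono_on (by linarith) (hg.intervalIntegrable _ _) (hi _ _) h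
  have C : ∫ y in (a + l)..1, c ≤ ∫ y in (a + l)..1, offerValue (optimalValue k) r y :=
    intervalIntegral.integral_mono_on hal (by simp) (hi _ _)
      fun y _ => hc.trans (le_offerValue _ r y)
  have D : optimalValue (k + 1) r = ∫ y in (0 : ℝ)..1, offerValue (optimalValue k) r y := rfl
  rw [D, ← intervalIntegral.integral_add_adjacent_intervals (hi 0 a) (hi a 1),
    ← intervalIntegral.integral_add_adjacent_intervals (hi a (a + l)) (hi (a + l) 1),
    intervalIntegral.integral_sub (hg.intervalIntegrable _ _) (by simp)]
  simp only [intervalIntegral.integral_const, smul_eq_mul] at A C ⊢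
  linarith

/-- The subtracted 2 handles the end: once the remaining distance is below `l`, the minorant is at
most 2. Before that, the whole window fits. -/
lemma minorant_le_optimalValue_falling {l e : ℝ} (hl : 0 < l) (he : 0 < e) (k : ℕ) :
    ∀ r, 1 ≤ r → minorant l e k (2 - r) - 2 ≤ optimalValue k r := by
  induction k with
  | zero =>
    intro r _
    have := minorant_zero_le (b := 2 - r) hl he
    simp only [optimalValue, Nat.cast_zero]
    linarith
  | succ k ih =>
    intro r hr
    rcases lt_or_ge (2 - r) l with h | h
    · have h1 := minorant_le (b := 2 - r) hl he (Nat.cast_nonneg (k + 1))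
      have h2 : 2 * (2 - r) / l ≤ 2 := by rw [div_le_iff₀ hl]; linarith
      linarith [optimalValue_nonneg (k + 1) r]
    · have hw := window_le_optimalValue_succ (k := k) (r := r) (a := 2 - r - l) (l := l) hl
        (by linarith) (by linarith) (g := fun y => 1 + (minorant l e k y - 2))
        (by have := continuous_minorant l e k; fun_prop) (ih r hr) ?_
      · have hs := minorant_succ_le (k := k) (b := 2 - r) hl he
        have e1 : ∫ c in (0 : ℝ)..l, (1 + minorant l e k (2 - r - c) - minorant l e k (2 - r))
            = ∫ y in (2 - r - l)..(2 - r - l + l),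
              (1 + (minorant l e k y - 2) - (minorant l e k (2 - r) - 2)) := by
          rw [intervalIntegral.integral_comp_sub_left
            (fun y => 1 + minorant l e k y - minorant l e k (2 - r)) (2 - r)]
          simp only [sub_zero, sub_add_cancel]
          congr 1; ext y; ring
        rw [e1] at hs
        push_cast
        linarith
      · intro y hy
        have hf : r ≤ 2 - y := by linarith [hy.2]
        refine le_trans ?_ (add_one_le_offerValue _ hf)
        -- Here `r ≤ y` forces `r = y = 1`, where both branches of `turn` agree.
        rcases le_or_gt r y with hry | hry
        · have : y = 1 := by linarith
          have h3 := ih y (by linarith)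
          rw [turn, if_pos hry]
          rw [this] at h3 ⊢
          norm_num at h3 ⊢
          linarith
        · rw [turn, if_neg (by linarith)]
          have h3 := ih (2 - y) (by linarith)
          rw [sub_sub_cancel] at h3
          linarith

/-- When the window no longer fits below 1, distance `2 * l` is given up to pass to a falling
position, which monotonicity of the value permits. -/
lemma minorant_le_optimalValue_rising {l e : ℝ} (hl : 0 < l) (he : 0 < e) (k : ℕ) :
    ∀ r, 0 ≤ r → r ≤ 1 → minorant l e k (2 - 2 * l - r) - 2 ≤ optimalValue k r := by
  induction k with
  | zero =>
    intro r _ _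
    have := minorant_zero_le (b := 2 - 2 * l - r) hl he
    simp only [optimalValue, Nat.cast_zero]
    linarith
  | succ k ih =>
    intro r h0 h1
    rcases lt_or_ge (1 - l) r with h | h
    · have h2 := minorant_le_optimalValue_falling hl he (k + 1) (r + 2 * l) (by linarith)
      have h3 := optimalValue_antitone (k + 1) (show r ≤ r + 2 * l by linarith)
      rw [show 2 - (r + 2 * l) = 2 - 2 * l - r by ring] at h2
      linarith
    · have hw := window_le_optimalValue_succ (k := k) (r := r) (a := r) (l := l) hl
        h0 (by linarith) (g := fun y => 1 + (minorant l e k (2 - 2 * l - y) - 2))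
        (by have := continuous_minorant l e k; fun_prop) (ih r h0 h1) ?_
      · have hs := minorant_succ_le (k := k) (b := 2 - 2 * l - r) hl he
        have e1 : ∫ c in (0 : ℝ)..l,
            (1 + minorant l e k (2 - 2 * l - r - c) - minorant l e k (2 - 2 * l - r))
            = ∫ y in r..(r + l),
              (1 + (minorant l e k (2 - 2 * l - y) - 2) - (minorant l e k (2 - 2 * l - r) - 2)) := by
          have := intervalIntegral.integral_comp_add_left (a := 0) (b := l)
            (fun y => 1 + (minorant l e k (2 - 2 * l - y) - 2) -
              (minorant l e k (2 - 2 * l - r) - 2)) r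
          simp only [add_zero] at this
          rw [← this]
          congr 1; ext y
          rw [sub_sub (2 - 2 * l) r y]; ring
        rw [e1] at hs
        push_cast
        linarith
      · intro y hy
        have hf : r ≤ 2 - y := by linarith [hy.2]
        refine le_trans ?_ (add_one_le_offerValue _ hf)
        rw [turn, if_pos hy.1]
        have h3 := ih y (by linarith [hy.1]) (by linarith [hy.2])
        linarith

lemma two_mul_sqrt_sub_le_optimalValue {n : ℕ} (hn : 1 ≤ n) :
    2 * √(n : ℝ) - (n : ℝ) ^ (1 / 4 : ℝ) - 10 ≤ optimalValue n 0 := by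
  set q : ℝ := (n : ℝ) ^ (1 / 4 : ℝ) with hq
  have hn' : (1 : ℝ) ≤ n := by exact_mod_cast hn
  have hq1 : 1 ≤ q := Real.one_le_rpow hn' (by norm_num)
  have hsq : √(n : ℝ) = q ^ 2 := by
    rw [Real.sqrt_eq_rpow, hq, ← Real.rpow_natCast, ← Real.rpow_mul (by positivity)]
    norm_num
  have hnq : (n : ℝ) = q ^ 4 := by
    rw [hq, ← Real.rpow_natCast, ← Real.rpow_mul (by positivity)]
    norm_num
  have hq0 : 0 < q := by linarith
  -- With `l = 2/√n` both estimates are near 2√n. Then `e / 4` and `n * l / (3 * e)` are both of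
  -- order `q` when `e` is; they add up to `5 / 6 * q`.
  have h := minorant_le_optimalValue_rising (l := 2 / q ^ 2) (e := 2 * q) (by positivity)
    (by positivity) n 0 le_rfl zero_le_one
  rw [hsq]
  refine le_trans ?_ h
  have key : minorant (2 / q ^ 2) (2 * q) n (2 - 2 * (2 / q ^ 2) - 0) =
      2 * q ^ 2 - 5 / 6 * q - 2 - 2 / q := by
    unfold minorant; rw [hnq]; field_simp; ring
  rw [key]
  have : 2 / q ≤ 2 := by rw [div_le_iff₀ hq0]; linarith
  linarith

end UnimodalSelection

namespace UnimodalSelection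

/-! ### Paths of positions -/

/-- `R i` is the position before the offer with index `i`, when exactly the values `y i` with
`i ∈ S` are selected. -/
structure IsPositionPath {n : ℕ} (y : Fin n → ℝ) (S : Set (Fin n)) (R : ℕ → ℝ) : Prop where
  zero : R 0 = 0
  selected : ∀ i ∈ S, R (i + 1) = turn (R i) (y i)
  skipped : ∀ i ∉ S, R (i + 1) = R i

lemma IsUnimodalOn.position_le {n : ℕ} {x y : Fin n → ℝ} {S : Set (Fin n)} {R : ℕ → ℝ}
    (hS : IsUnimodalOn x S) (hxy : ∀ i j, x i ≤ x j → y i ≤ y j) (h0 : ∀ i, 0 ≤ y i)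
    (h1 : ∀ i, y i ≤ 1) (hR : IsPositionPath y S R) : ∀ i ∈ S, R i ≤ 2 - y i := by
  rcases hS with rfl | ⟨t, htS, hm, ha⟩
  · simp
  -- The second bound makes `turn` take its rising branch up to the peak `t`.
  suffices H : ∀ k : ℕ, k ≤ n → (∀ j ∈ S, k ≤ (j : ℕ) → R k ≤ 2 - y j) ∧
      ∀ j ∈ S, k ≤ (j : ℕ) → j ≤ t → R k ≤ y j from
    fun i hi => (H i i.2.le).1 i hi le_rfl
  intro k
  induction k with
  | zero =>
    intro _
    rw [hR.zero]
    exact ⟨fun j _ _ => by linarith [h1 j], fun j _ _ _ => h0 j⟩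
  | succ k ih =>
    intro hk
    obtain ⟨ih1, ih2⟩ := ih (by omega)
    set i : Fin n := ⟨k, hk⟩ with hi
    by_cases hiS : i ∈ S
    · have hsel : R (k + 1) = turn (R k) (y i) := hR.selected i hiS
      rcases le_or_gt i t with hit | hit
      · have h2 : R (k + 1) = y i := by rw [hsel, turn, if_pos (ih2 i hiS le_rfl hit)]
        rw [h2]
        refine ⟨fun j _ _ => by linarith [h1 i, h1 j], fun j hj hkj hjt => hxy _ _ ?_⟩
        exact hm ⟨hiS, hit⟩ ⟨hj, hjt⟩ (by rw [Fin.le_def]; simp only [hi]; omega)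
      · have h2 : R (k + 1) ≤ 2 - y i := by
          -- A tie after the peak may leave the position in the rising half, which only makes it
          -- smaller.
          rw [hsel, turn]; split_ifs <;> linarith [h1 i]
        refine ⟨fun j hj hkj => ?_, fun j hj hkj hjt => ?_⟩
        · have : i ≤ j := by rw [Fin.le_def]; simp only [hi]; omega
          have := hxy _ _ (ha ⟨hiS, hit.le⟩ ⟨hj, hit.le.trans this⟩ this)
          linarith
        · rw [Fin.lt_def] at hit
          rw [Fin.le_def] at hjt
          simp only [hi] at hit
          omega
    · have hskip : R (k + 1) = R k := hR.skipped i hiS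
      rw [hskip]
      exact ⟨fun j hj hkj => ih1 j hj (by omega), fun j hj hkj => ih2 j hj (by omega)⟩

/-- The inequalities are strict because the distribution function can be flat: equal `y` values do
not order the `x` values, whereas strict ones do. -/
lemma IsPositionPath.isUnimodalOn {n : ℕ} {x y : Fin n → ℝ} {S : Set (Fin n)} {R : ℕ → ℝ}
    (hR : IsPositionPath y S R) (hxy : ∀ i j, y i < y j → x i < x j) (h0 : ∀ i, 0 ≤ y i)
    (hS : ∀ i ∈ S, R i ≠ y i ∧ R i < 2 - y i) : IsUnimodalOn x S := by
  -- Before offer `k`, either nothing is selected, or `t` is the peak so far. In the latter case the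
  -- position is still `y t`, or it is in the falling half and `2 - R k` bounds the values since `t`
  -- from below.
  suffices H : ∀ k : ℕ, k ≤ n → ((∀ i ∈ S, ¬ (i : ℕ) < k) ∧ R k = 0) ∨
      ∃ t ∈ S, (t : ℕ) < k ∧ (∀ i ∈ S, ∀ j ∈ S, i ≤ j → j ≤ t → x i ≤ x j) ∧
        (∀ i ∈ S, ∀ j ∈ S, (j : ℕ) < k → t ≤ i → i ≤ j → x j ≤ x i) ∧
        ((R k = y t ∧ ∀ j ∈ S, (j : ℕ) < k → j ≤ t) ∨
          (1 ≤ R k ∧ ∀ j ∈ S, (j : ℕ) < k → t ≤ j → 2 - R k ≤ y j)) by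
    rcases H n le_rfl with ⟨h, _⟩ | ⟨t, ht, _, hm, ha, _⟩
    · left
      ext i
      exact ⟨fun hi => absurd i.2 (h i hi), fun hi => hi.elim⟩
    · right
      exact ⟨t, ht, fun i hi j hj hij => hm i hi.1 j hj.1 hij hj.2,
        fun i hi j hj hij => ha i hi.1 j hj.1 j.2 hi.2 hij⟩
  intro k
  induction k with
  | zero => exact fun _ => Or.inl ⟨by simp, hR.zero⟩
  | succ k ih =>
    intro hk
    have ih := ih (by omega)
    set i : Fin n := ⟨k, hk⟩ with hi
    have hik : (i : ℕ) = k := rfl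
    have before : ∀ j : Fin n, (j : ℕ) < k + 1 → (j : ℕ) < k ∨ j = i := fun j hj => by
      rcases Nat.lt_succ_iff_lt_or_eq.1 hj with h | h
      · exact Or.inl h
      · exact Or.inr (Fin.ext h)
    by_cases hiS : i ∈ S
    · have hsel : R (k + 1) = turn (R k) (y i) := hR.selected i hiS
      obtain ⟨hne, hlt⟩ : R k ≠ y i ∧ R k < 2 - y i := hS i hiS
      right
      rcases lt_or_gt_of_ne hne with hup | hdown
      · rw [turn, if_pos hup.le] at hsel
        have hpast : ∀ j ∈ S, (j : ℕ) < k → x j < x i := by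
          rcases ih with ⟨h, _⟩ | ⟨t, ht, htk, hm, _, ⟨hRt, hlast⟩ | ⟨hR1, _⟩⟩
          · exact fun j hj hjk => absurd hjk (h j hj)
          · exact fun j hj hjk => (hm j hj t ht (hlast j hj hjk) le_rfl).trans_lt
              (hxy _ _ (hRt ▸ hup))
          · linarith
        have hmono : ∀ a ∈ S, ∀ b ∈ S, a ≤ b → (b : ℕ) < k → x a ≤ x b := by
          rcases ih with ⟨h, _⟩ | ⟨t, ht, htk, hm, _, ⟨hRt, hlast⟩ | ⟨hR1, _⟩⟩
          · exact fun a ha b hb _ hbk => absurd hbk (h b hb)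
          · exact fun a ha b hb hab hbk => hm a ha b hb hab (hlast b hb hbk)
          · linarith
        refine ⟨i, hiS, by omega, fun a ha b hb hab hbi => ?_, fun a ha b hb hbk hia hab => ?_,
          Or.inl ⟨hsel, fun j _ hj => ?_⟩⟩
        · rcases hbi.lt_or_eq with h | rfl
          · exact hmono a ha b hb hab (Fin.lt_def.1 h)
          · rcases hab.lt_or_eq with h | rfl
            · exact (hpast a ha (Fin.lt_def.1 h)).le
            · exact le_rfl
        · have e1 : b = i := by
            apply Fin.ext; have := Fin.le_def.1 hia; have := Fin.le_def.1 hab; omega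
          have e2 : a = i := le_antisymm (e1 ▸ hab) hia
          rw [e1, e2]
        · rw [Fin.le_def]; omega
      · rw [turn, if_neg (by linarith)] at hsel
        have hR1 : 1 ≤ R (k + 1) := by linarith
        rcases ih with ⟨_, h⟩ | ⟨t, ht, htk, hm, ha, hc⟩
        · linarith [h0 i]
        · have hpast : ∀ j ∈ S, (j : ℕ) < k → t ≤ j → y i < y j := by
            rcases hc with ⟨hRt, hlast⟩ | ⟨_, hd⟩
            · intro j hj hjk htj
              rw [le_antisymm (hlast j hj hjk) htj, ← hRt]
              exact hdown
            · intro j hj hjk htj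
              linarith [hd j hj hjk htj]
          refine ⟨t, ht, by omega, hm, fun a haS b hb hbk hta hab => ?_,
            Or.inr ⟨hR1, fun j hj hjk htj => ?_⟩⟩
          · rcases before b hbk with h | rfl
            · exact ha a haS b hb h hta hab
            · rcases hab.lt_or_eq with h | rfl
              · exact (hxy _ _ (hpast a haS (Fin.lt_def.1 h) hta)).le
              · exact le_rfl
          · rw [hsel, sub_sub_cancel]
            rcases before j hjk with h | rfl
            · exact (hpast j hj h htj).le
            · exact le_rfl
    · have hskip : R (k + 1) = R k := hR.skipped i hiS
      have old : ∀ j ∈ S, (j : ℕ) < k + 1 → (j : ℕ) < k := fun j hj hjk =>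
        (before j hjk).resolve_right fun h => hiS (h ▸ hj)
      rw [hskip]
      rcases ih with ⟨h, h'⟩ | ⟨t, ht, htk, hm, ha, hc⟩
      · exact Or.inl ⟨fun j hj hjk => h j hj (old j hj hjk), h'⟩
      · refine Or.inr ⟨t, ht, by omega, hm, fun a haS b hb hbk => ha a haS b hb (old b hb hbk), ?_⟩
        rcases hc with ⟨hRt, hlast⟩ | ⟨hR1, hd⟩
        · exact Or.inl ⟨hRt, fun j hj hjk => hlast j hj (old j hj hjk)⟩
        · exact Or.inr ⟨hR1, fun j hj hjk => hd j hj (old j hj hjk)⟩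

open Classical in
-- The rule `A` may consult the position, which serves the Bellman rule; a given policy simply
-- ignores it.
lemma exists_isPositionPath {Ω : Type*} {n : ℕ} (Y : Fin n → Ω → ℝ)
    (A : Fin n → ℝ → Set Ω) : ∃ R : ℕ → Ω → ℝ,
      ∀ ω, IsPositionPath (fun i => Y i ω) {i | ω ∈ A i (R i ω)} fun k => R k ω := by
  let R : ℕ → Ω → ℝ := fun k => Nat.rec (fun _ => 0) (fun k r ω =>
    if h : k < n then if ω ∈ A ⟨k, h⟩ (r ω) then turn (r ω) (Y ⟨k, h⟩ ω) else r ω else r ω) k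
  have hs : ∀ (i : Fin n) ω, R (i + 1) ω =
      if ω ∈ A i (R i ω) then turn (R i ω) (Y i ω) else R i ω := fun i ω => dif_pos i.2
  refine ⟨R, fun ω => ⟨rfl, fun i hi => ?_, fun i hi => ?_⟩⟩
  · exact (hs i ω).trans (if_pos hi)
  · exact (hs i ω).trans (if_neg hi)

/-! ### Uniform observations -/

/-- For 0 ≤ t < 1 a nonempty sublevel set of `F` is a closed half-line ending at some `a`, and
continuity forces `F a = t`. -/
lemma map_eq_uniform_of_continuous {μ : Measure ℝ} [IsProbabilityMeasure μ] {F : ℝ → ℝ}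
    (hF : Continuous F) (h : ∀ x, μ.real (Set.Iic x) = F x) :
    μ.map F = volume.restrict (Set.Icc 0 1) := by
  have hcdf : (cdf μ : ℝ → ℝ) = F := by ext x; rw [cdf_eq_real, h]
  have hmono : Monotone F := hcdf ▸ monotone_cdf μ
  have hbot : Filter.Tendsto F Filter.atBot (nhds 0) := hcdf ▸ tendsto_cdf_atBot μ
  have htop : Filter.Tendsto F Filter.atTop (nhds 1) := hcdf ▸ tendsto_cdf_atTop μ
  have h0 : ∀ x, 0 ≤ F x := fun x => hcdf ▸ cdf_nonneg μ x
  have h1 : ∀ x, F x ≤ 1 := fun x => hcdf ▸ cdf_le_one μ x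
  have := Measure.isProbabilityMeasure_map (μ := μ) hF.measurable.aemeasurable
  refine Measure.ext_of_Iic _ _ fun t => ?_
  rw [Measure.map_apply hF.measurable measurableSet_Iic, Measure.restrict_apply measurableSet_Iic]
  rcases lt_or_ge t 0 with ht | ht
  · have e1 : F ⁻¹' Set.Iic t = ∅ := by
      ext x; simpa using ht.trans_le (h0 x)
    have e2 : Set.Iic t ∩ Set.Icc (0 : ℝ) 1 = ∅ := by
      ext x; simp only [Set.mem_inter_iff, Set.mem_Iic, Set.mem_Icc, Set.mem_empty_iff_false,
        iff_false]
      rintro ⟨h2, h3, _⟩; linarith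
    rw [e1, e2]; simp
  rcases le_or_gt 1 t with ht1 | ht1
  · have e1 : F ⁻¹' Set.Iic t = Set.univ := by
      ext x; simpa using (h1 x).trans ht1
    have e2 : Set.Iic t ∩ Set.Icc (0 : ℝ) 1 = Set.Icc 0 1 :=
      Set.inter_eq_right.2 fun x hx => hx.2.trans ht1
    rw [e1, e2]; simp
  have e2 : Set.Iic t ∩ Set.Icc (0 : ℝ) 1 = Set.Icc 0 t := by
    ext x; simp only [Set.mem_inter_iff, Set.mem_Iic, Set.mem_Icc]
    constructor
    · rintro ⟨h2, h3, _⟩; exact ⟨h3, h2⟩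
    · rintro ⟨h2, h3⟩; exact ⟨h3, h2, h3.trans ht1.le⟩
  rw [e2, Real.volume_Icc, sub_zero]
  rcases (F ⁻¹' Set.Iic t).eq_empty_or_nonempty with he | hne
  · have : t ≤ 0 := ge_of_tendsto' hbot fun x => by
      have : x ∉ F ⁻¹' Set.Iic t := he ▸ Set.notMem_empty x
      exact (not_le.1 this).le
    rw [he, ENNReal.ofReal_of_nonpos this]; simp
  · obtain ⟨b, hb⟩ := (htop.eventually_const_lt ht1).exists
    have hbdd : BddAbove (F ⁻¹' Set.Iic t) :=
      ⟨b, fun x hx => le_of_lt (hmono.reflect_lt (lt_of_le_of_lt hx hb))⟩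
    have hcl : IsClosed (F ⁻¹' Set.Iic t) := isClosed_Iic.preimage hF
    set a := sSup (F ⁻¹' Set.Iic t) with ha
    have hmem : F a ≤ t := hcl.csSup_mem hne hbdd
    have hset : F ⁻¹' Set.Iic t = Set.Iic a := by
      ext x
      exact ⟨fun hx => le_csSup hbdd hx, fun hx => (hmono hx).trans hmem⟩
    have hFa : F a = t := by
      refine le_antisymm hmem ?_
      refine ge_of_tendsto (hF.continuousWithinAt (s := Set.Ioi a) (x := a)) ?_
      filter_upwards [self_mem_nhdsWithin] with x hx
      by_contra hcon
      exact absurd (le_csSup hbdd (not_le.1 hcon).le) (not_le.2 hx)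
    rw [hset, ← ofReal_measureReal, h, hFa]

/-- The information that the observations before the one with index `k` provide. -/
@[reducible] def observedBefore {Ω : Type*} {n : ℕ} (X : Fin n → Ω → ℝ) (k : ℕ) : MeasurableSpace Ω :=
  ⨆ j : Fin n, ⨆ _ : (j : ℕ) < k, MeasurableSpace.comap (X j) inferInstance

section

variable {Ω : Type*} {n : ℕ} {X : Fin n → Ω → ℝ}

lemma observedBefore_mono (X : Fin n → Ω → ℝ) : Monotone (observedBefore X) := fun _ _ h =>
  iSup_mono fun _ => iSup_mono' fun hj => ⟨hj.trans_le h, le_rfl⟩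

lemma observedUpTo_eq (X : Fin n → Ω → ℝ) (i : Fin n) :
    observedUpTo X i = observedBefore X (i + 1) := by
  unfold observedUpTo observedBefore
  simp only [Fin.le_def, Nat.lt_succ_iff]

lemma measurable_observedBefore_succ (X : Fin n → Ω → ℝ) (i : Fin n) :
    Measurable[observedBefore X (i + 1)] (X i) :=
  Measurable.mono (comap_measurable (X i))
    (le_iSup₂_of_le (f := fun (j : Fin n) (_ : (j : ℕ) < i + 1) =>
      MeasurableSpace.comap (X j) inferInstance) i (Nat.lt_succ_self _) le_rfl) le_rfl

lemma observedBefore_le [m : MeasurableSpace Ω] (hX : ∀ i, Measurable (X i)) (k : ℕ) :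
    observedBefore X k ≤ m :=
  iSup₂_le fun i _ => (hX i).comap_le

/-- Selections may depend on the position and the position on earlier selections, so `hS` asks for
measurability of the selection only given that of the current position. -/
lemma measurable_position {F : ℝ → ℝ} (hF : Measurable F) {S : Fin n → Set Ω} {R : ℕ → Ω → ℝ}
    (hR : ∀ ω, IsPositionPath (fun i => F (X i ω)) {i | ω ∈ S i} fun k => R k ω)
    (hS : ∀ i : Fin n, Measurable[observedBefore X i] (R i) →
      MeasurableSet[observedBefore X (i + 1)] (S i)) :
    ∀ k ≤ n, Measurable[observedBefore X k] (R k) := by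
  classical
  intro k
  induction k with
  | zero =>
    intro _
    have : R 0 = fun _ => 0 := funext fun ω => (hR ω).zero
    rw [this]
    exact measurable_const
  | succ k ih =>
    intro hk
    have ih := ih (by omega)
    let i : Fin n := ⟨k, hk⟩
    have hRk : Measurable[observedBefore X (k + 1)] (R k) :=
      ih.mono (observedBefore_mono X k.le_succ) le_rfl
    have hY : Measurable[observedBefore X (k + 1)] fun ω => F (X i ω) :=
      hF.comp (measurable_observedBefore_succ X i)
    have e : R (k + 1) = fun ω => if ω ∈ S i then turn (R k ω) (F (X i ω)) else R k ω := by
      ext ω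
      split_ifs with h
      · exact (hR ω).selected i h
      · exact (hR ω).skipped i h
    rw [e]
    exact Measurable.ite (hS i ih) (measurable_turn.comp (hRk.prodMk hY)) hRk

variable [MeasurableSpace Ω] {P : Measure Ω}

lemma indep_observedBefore (hX : ∀ i, Measurable (X i)) (hind : iIndepFun X P) (i : Fin n) :
    Indep (observedBefore X i) (MeasurableSpace.comap (X i) inferInstance) P := by
  have h := indep_iSup_of_disjoint (fun j => (hX j).comap_le) hind
    (S := {j : Fin n | (j : ℕ) < i}) (T := {i}) (by simp)
  rwa [iSup_singleton] at h

variable [IsProbabilityMeasure P]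

lemma map_prodMk_uniform {Z Y : Ω → ℝ} (hZ : Measurable Z) (hY : Measurable Y)
    (hind : IndepFun Z Y P) (hu : P.map Y = volume.restrict (Set.Icc 0 1)) :
    P.map (fun ω => (Z ω, Y ω)) = (P.map Z).prod (volume.restrict (Set.Icc 0 1)) := by
  rw [← hu]
  exact (indepFun_iff_map_prod_eq_prod_map_map hZ.aemeasurable hY.aemeasurable).1 hind

lemma integrable_optimalValue (k : ℕ) {Z : Ω → ℝ} (hZ : Measurable Z) :
    Integrable (fun ω => optimalValue k (Z ω)) P :=
  Integrable.of_bound ((measurable_optimalValue k).comp hZ).aestronglyMeasurable k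
    (Filter.Eventually.of_forall fun ω => by
      rw [Real.norm_of_nonneg (optimalValue_nonneg k _)]; exact optimalValue_le k _)

lemma integrable_offerValue {α : Type*} [MeasurableSpace α] {μ : Measure α} [IsFiniteMeasure μ]
    (k : ℕ) {Z : α → ℝ × ℝ} (hZ : Measurable Z) :
    Integrable (fun a => offerValue (optimalValue k) (Z a).1 (Z a).2) μ :=
  Integrable.of_bound
    ((measurable_offerValue (measurable_optimalValue k)).comp hZ).aestronglyMeasurable (1 + k)
    (Filter.Eventually.of_forall fun a => by
      rw [Real.norm_of_nonneg ((optimalValue_nonneg k _).trans (le_offerValue _ _ _))]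
      exact offerValue_le (optimalValue_le k) _ _)

lemma integral_offerValue {Z Y : Ω → ℝ} (hZ : Measurable Z) (hY : Measurable Y)
    (hind : IndepFun Z Y P) (hu : P.map Y = volume.restrict (Set.Icc 0 1)) (k : ℕ) :
    ∫ ω, offerValue (optimalValue k) (Z ω) (Y ω) ∂P = ∫ ω, optimalValue (k + 1) (Z ω) ∂P := by
  have := Measure.isProbabilityMeasure_map (μ := P) hZ.aemeasurable
  have hm := measurable_offerValue (measurable_optimalValue k)
  have e1 := integral_map (μ := P) (hZ.prodMk hY).aemeasurable
    (f := fun p : ℝ × ℝ => offerValue (optimalValue k) p.1 p.2) hm.aestronglyMeasurable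
  rw [← e1, map_prodMk_uniform hZ hY hind hu,
    integral_prod (fun p : ℝ × ℝ => offerValue (optimalValue k) p.1 p.2)
      (integrable_offerValue k measurable_id),
    ← integral_map (μ := P) hZ.aemeasurable
      (measurable_optimalValue (k + 1)).aestronglyMeasurable]
  congr 1
  ext r
  simp only [optimalValue]
  rw [intervalIntegral.integral_of_le zero_le_one, integral_Icc_eq_integral_Ioc]

/-- Applied to `R i` and `2 - R i`, this makes the refusal of ties in the optimal policy free of
cost. -/
lemma ae_ne_uniform {Z Y : Ω → ℝ} (hZ : Measurable Z) (hY : Measurable Y)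
    (hind : IndepFun Z Y P) (hu : P.map Y = volume.restrict (Set.Icc 0 1)) :
    ∀ᵐ ω ∂P, Z ω ≠ Y ω := by
  have := Measure.isProbabilityMeasure_map (μ := P) hZ.aemeasurable
  have hs : MeasurableSet {p : ℝ × ℝ | p.1 = p.2} :=
    measurableSet_eq_fun measurable_fst measurable_snd
  have h : P.map (fun ω => (Z ω, Y ω)) {p : ℝ × ℝ | p.1 = p.2} = 0 := by
    rw [map_prodMk_uniform hZ hY hind hu, Measure.measure_prod_null hs]
    refine Filter.Eventually.of_forall fun r => ?_
    have : Prod.mk r ⁻¹' {p : ℝ × ℝ | p.1 = p.2} = {r} := by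
      ext y; simp [eq_comm]
    simp [this]
  rw [Measure.map_apply (hZ.prodMk hY) hs] at h
  rw [ae_iff]
  simpa using h

/-! ### Optimality -/

lemma IsIIDContinuous.exists_uniform (hX : IsIIDContinuous P X) :
    ∃ F : ℝ → ℝ, Monotone F ∧ (∀ i ω, 0 ≤ F (X i ω)) ∧ (∀ i ω, F (X i ω) ≤ 1) ∧
      ∀ i, P.map (fun ω => F (X i ω)) = volume.restrict (Set.Icc 0 1) := by
  obtain ⟨F, hF, h⟩ := hX.common_cdf
  rcases isEmpty_or_nonempty (Fin n) with he | ⟨⟨i₀⟩⟩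
  · exact ⟨id, monotone_id, he.elim, he.elim, he.elim⟩
  have hreal : ∀ i x, (P.map (X i)).real (Set.Iic x) = F x := fun i x => by
    rw [map_measureReal_apply (hX.measurable i) measurableSet_Iic]
    exact h i x
  have hp : ∀ i, IsProbabilityMeasure (P.map (X i)) := fun i =>
    Measure.isProbabilityMeasure_map (hX.measurable i).aemeasurable
  have hcdf : (cdf (P.map (X i₀)) : ℝ → ℝ) = F := by
    ext x
    have := hp i₀
    rw [cdf_eq_real, hreal]
  refine ⟨F, hcdf ▸ monotone_cdf _, fun i ω => hcdf ▸ cdf_nonneg _ _,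
    fun i ω => hcdf ▸ cdf_le_one _ _, fun i => ?_⟩
  have := hp i
  rw [← map_eq_uniform_of_continuous hF (hreal i),
    Measure.map_map hF.measurable (hX.measurable i)]
  rfl

lemma FeasiblePolicy.measurableSet_select (hX : ∀ i, Measurable (X i)) (π : FeasiblePolicy X)
    (i : Fin n) : MeasurableSet (π.select i) :=
  (observedUpTo_eq X i ▸ observedBefore_le hX _ : observedUpTo X i ≤ _) _ (π.nonanticipating i)

lemma FeasiblePolicy.expectedLength_eq_sum (hX : ∀ i, Measurable (X i)) (π : FeasiblePolicy X) :
    π.expectedLength P = ∑ i, P.real (π.select i) := by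
  classical
  have h : ∀ ω, (π.length ω : ℝ) = ∑ i, (π.select i).indicator (fun _ => (1 : ℝ)) ω := by
    intro ω
    simp only [length, Set.indicator_apply, Finset.sum_boole]
    rw [Set.ncard_eq_toFinset_card']
    congr 2
    ext i
    simp
  unfold expectedLength
  simp only [h]
  rw [integral_finsetSum _ fun i _ => (integrable_const (1 : ℝ)).indicator
    (π.measurableSet_select hX i)]
  refine Finset.sum_congr rfl fun i _ => ?_
  rw [integral_indicator_const _ (π.measurableSet_select hX i)]
  simp

/-- The expected gain of one step, in terms of the values of the positions. -/
lemma measureReal_add_integral_eq {S : Set Ω} (hS : MeasurableSet S) {R' : Ω → ℝ}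
    (hR' : Measurable R') (k : ℕ) :
    ∫ ω, (S.indicator (fun _ => (1 : ℝ)) ω + optimalValue k (R' ω)) ∂P =
      P.real S + ∫ ω, optimalValue k (R' ω) ∂P := by
  rw [integral_add ((integrable_const (1 : ℝ)).indicator hS) (integrable_optimalValue k hR'),
    integral_indicator_const _ hS]
  simp

lemma sum_telescope {p : Fin n → ℝ} {a : ℕ → ℝ} (h : ∀ i : Fin n, p i = a i - a (i + 1)) :
    ∑ i, p i = a 0 - a n := by
  rw [Finset.sum_congr rfl fun i _ => h i, Fin.sum_univ_eq_sum_range (fun i => a i - a (i + 1)),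
    Finset.sum_range_sub']

/-- The position depends only on earlier observations, so the next one is independent of it and
averaging the offer gives the Bellman integral. No decision beats the offer value; summing
telescopes. -/
theorem IsIIDContinuous.expectedLength_le (hX : IsIIDContinuous P X) (π : FeasiblePolicy X) :
    π.expectedLength P ≤ optimalValue n 0 := by
  obtain ⟨F, hF, h0, h1, hu⟩ := hX.exists_uniform
  obtain ⟨R, hR⟩ := exists_isPositionPath (fun i ω => F (X i ω)) fun i _ => π.select i
  have hRm := measurable_position hF.measurable hR
    fun i _ => observedUpTo_eq X i ▸ π.nonanticipating i
  have hRm' : ∀ k ≤ n, Measurable (R k) := fun k hk =>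
    (hRm k hk).mono (observedBefore_le hX.measurable k) le_rfl
  have hYm : ∀ i, Measurable fun ω => F (X i ω) := fun i => hF.measurable.comp (hX.measurable i)
  have step : ∀ i : Fin n, P.real (π.select i) ≤
      (∫ ω, optimalValue (n - i) (R i ω) ∂P) -
        ∫ ω, optimalValue (n - (i + 1)) (R (i + 1) ω) ∂P := by
    intro i
    have hind : IndepFun (R i) (fun ω => F (X i ω)) P := by
      have := indep_observedBefore hX.measurable hX.indep i
      exact indep_of_indep_of_le_left (indep_of_indep_of_le_right this
        (hF.measurable.comp (comap_measurable (X i))).comap_le) (hRm i i.2.le).comap_le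
    have e := integral_offerValue (hRm' i i.2.le) (hYm i) hind (hu i) (n - (i + 1))
    rw [show n - (i + 1) + 1 = n - (i : ℕ) by omega] at e
    rw [← e, le_sub_iff_add_le, ← measureReal_add_integral_eq
      (π.measurableSet_select hX.measurable i) (hRm' (i + 1) i.2)]
    refine integral_mono (((integrable_const (1 : ℝ)).indicator
      (π.measurableSet_select hX.measurable i)).add
      (integrable_optimalValue _ (hRm' (i + 1) i.2)))
      (integrable_offerValue _ ((hRm' i i.2.le).prodMk (hYm i))) fun ω => ?_
    by_cases hω : ω ∈ π.select i
    · have hfeas := (π.unimodal ω).position_le (y := fun i => F (X i ω)) (fun i j h => hF h)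
        (fun i => h0 i ω) (fun i => h1 i ω) (hR ω) i hω
      have hs := (hR ω).selected i hω
      simp only [Set.indicator_of_mem hω, hs]
      exact add_one_le_offerValue _ hfeas
    · have hs := (hR ω).skipped i hω
      simp only [Set.indicator_of_notMem hω, hs, zero_add]
      exact le_offerValue _ _ _
  rw [π.expectedLength_eq_sum hX.measurable]
  refine (Finset.sum_le_sum fun i _ => step i).trans_eq ?_
  rw [sum_telescope (a := fun k => ∫ ω, optimalValue (n - k) (R k ω) ∂P) fun i => rfl]
  have hR0 : R 0 = fun _ => 0 := funext fun ω => (hR ω).zero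
  simp [hR0, optimalValue]

theorem IsIIDContinuous.exists_expectedLength_eq (hX : IsIIDContinuous P X) :
    ∃ π : FeasiblePolicy X, π.expectedLength P = optimalValue n 0 := by
  obtain ⟨F, hF, h0, h1, hu⟩ := hX.exists_uniform
  -- Accept when the recursion does not prefer skipping, excluding the ties that `isUnimodalOn`
  -- cannot handle.
  let D : ℕ → Set (ℝ × ℝ) := fun k => {p | p.1 ≠ p.2 ∧ p.1 < 2 - p.2 ∧
    optimalValue k p.1 ≤ 1 + optimalValue k (turn p.1 p.2)}
  have hD : ∀ k, MeasurableSet (D k) := fun k => by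
    have hm := measurable_optimalValue k
    exact (measurableSet_eq_fun measurable_fst measurable_snd).compl.inter
      ((measurableSet_lt measurable_fst (measurable_const.sub measurable_snd)).inter
        (measurableSet_le (hm.comp measurable_fst)
          (measurable_const.add (hm.comp measurable_turn))))
  obtain ⟨R, hR⟩ := exists_isPositionPath (fun i ω => F (X i ω))
    fun i r => {ω | (r, F (X i ω)) ∈ D (n - (i + 1))}
  let S : Fin n → Set Ω := fun i => {ω | (R i ω, F (X i ω)) ∈ D (n - (i + 1))}
  have hS : ∀ i : Fin n, Measurable[observedBefore X i] (R i) →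
      MeasurableSet[observedBefore X (i + 1)] (S i) := fun i hi => by
    have hY : Measurable[observedBefore X (i + 1)] fun ω => F (X i ω) :=
      hF.measurable.comp (measurable_observedBefore_succ X i)
    exact ((hi.mono (observedBefore_mono X (Nat.le_succ _)) le_rfl).prodMk hY) (hD _)
  have hRm := measurable_position (S := S) hF.measurable hR hS
  have hRm' : ∀ k ≤ n, Measurable (R k) := fun k hk =>
    (hRm k hk).mono (observedBefore_le hX.measurable k) le_rfl
  have hYm : ∀ i, Measurable fun ω => F (X i ω) := fun i => hF.measurable.comp (hX.measurable i)
  let π : FeasiblePolicy X :=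
    { select := S
      nonanticipating := fun i => observedUpTo_eq X i ▸ hS i (hRm i i.2.le)
      unimodal := fun ω => (hR ω).isUnimodalOn (fun i j h => hF.reflect_lt h) (fun i => h0 i ω)
        fun i hi => ⟨hi.1, hi.2.1⟩ }
  refine ⟨π, ?_⟩
  have step : ∀ i : Fin n, P.real (π.select i) =
      (∫ ω, optimalValue (n - i) (R i ω) ∂P) -
        ∫ ω, optimalValue (n - (i + 1)) (R (i + 1) ω) ∂P := by
    intro i
    have hind : IndepFun (R i) (fun ω => F (X i ω)) P := by
      have := indep_observedBefore hX.measurable hX.indep i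
      exact indep_of_indep_of_le_left (indep_of_indep_of_le_right this
        (hF.measurable.comp (comap_measurable (X i))).comap_le) (hRm i i.2.le).comap_le
    have e := integral_offerValue (hRm' i i.2.le) (hYm i) hind (hu i) (n - (i + 1))
    rw [show n - (i + 1) + 1 = n - (i : ℕ) by omega] at e
    rw [← e, eq_sub_iff_add_eq, ← measureReal_add_integral_eq
      (π.measurableSet_select hX.measurable i) (hRm' (i + 1) i.2)]
    have hind' : IndepFun (fun ω => 2 - R i ω) (fun ω => F (X i ω)) P :=
      hind.comp (measurable_const.sub measurable_id) measurable_id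
    -- Off the null set of ties the rule attains the maximum in `offerValue`, so the inequality of
    -- the upper bound becomes an equality.
    refine integral_congr_ae ?_
    filter_upwards [ae_ne_uniform (hRm' i i.2.le) (hYm i) hind (hu i),
      ae_ne_uniform ((hRm' i i.2.le).const_sub 2) (hYm i) hind' (hu i)] with ω hne hne'
    by_cases hω : ω ∈ π.select i
    · have hs := (hR ω).selected i hω
      simp only [Set.indicator_of_mem hω, hs]
      rw [offerValue, if_pos hω.2.1.le, max_eq_right hω.2.2]
    · have hs := (hR ω).skipped i hω
      simp only [Set.indicator_of_notMem hω, hs, zero_add]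
      unfold offerValue
      split_ifs with hle
      · refine (max_eq_left ?_).symm
        by_contra hcon
        refine hω ⟨hne, lt_of_le_of_ne hle fun h => hne' ?_, (not_le.1 hcon).le⟩
        simp only at h
        linarith
      · rfl
  rw [π.expectedLength_eq_sum hX.measurable,
    sum_telescope (a := fun k => ∫ ω, optimalValue (n - k) (R k ω) ∂P) step]
  have hR0 : R 0 = fun _ => 0 := funext fun ω => (hR ω).zero
  simp [hR0, optimalValue]

lemma IsIIDContinuous.isOptimal_iff (hX : IsIIDContinuous P X) (π : FeasiblePolicy X) :
    π.IsOptimal P ↔ π.expectedLength P = optimalValue n 0 := by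
  obtain ⟨ρ, hρ⟩ := hX.exists_expectedLength_eq
  have hlub : IsLUB (Set.range fun σ : FeasiblePolicy X => σ.expectedLength P)
      (optimalValue n 0) := by
    refine IsGreatest.isLUB ⟨⟨ρ, hρ⟩, ?_⟩
    rintro _ ⟨σ, rfl⟩
    exact hX.expectedLength_le σ
  exact ⟨fun h => h.unique hlub, fun h => by rw [FeasiblePolicy.IsOptimal, h]; exact hlub⟩

end

end UnimodalSelection

/-! ### The stated constant and the asymptotic equivalence -/

lemma UnimodalSelection.one_le_four_mul_sqrt_pi_div_six : 1 ≤ 4 * √(Real.pi / 6) := by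
  have h : (1 / 4 : ℝ) ≤ √(Real.pi / 6) := by
    apply Real.le_sqrt_of_sq_le
    linarith [Real.pi_gt_three]
  linarith

lemma UnimodalSelection.isEquivalent_two_mul_sqrt {a : ℕ → ℝ} {c C : ℝ}
    (hup : ∀ n : ℕ, 1 ≤ n → a n < 2 * √(n : ℝ))
    (hlow : ∀ n : ℕ, 1 ≤ n → 2 * √(n : ℝ) - c * (n : ℝ) ^ (1 / 4 : ℝ) - C < a n) :
    Asymptotics.IsEquivalent Filter.atTop a fun n : ℕ => 2 * √(n : ℝ) := by
  have hcast := tendsto_natCast_atTop_atTop (R := ℝ)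
  have hlim : (fun n : ℕ => c * (n : ℝ) ^ (1 / 4 : ℝ) + C) =o[Filter.atTop]
      fun n : ℕ => (n : ℝ) ^ (1 / 2 : ℝ) := by
    have hone : ∀ (d : ℝ) {p : ℝ}, 0 < p →
        (fun _ : ℕ => d) =o[Filter.atTop] fun n : ℕ => (n : ℝ) ^ p := fun d p hp =>
      Asymptotics.isLittleO_const_left.2 (Or.inr (tendsto_norm_atTop_atTop.comp
        ((tendsto_rpow_atTop hp).comp hcast)))
    refine Asymptotics.IsLittleO.add (Asymptotics.IsLittleO.const_mul_left ?_ c)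
      (hone C (by norm_num))
    refine ((Asymptotics.isBigO_refl (fun n : ℕ => (n : ℝ) ^ (1 / 4 : ℝ)) _).mul_isLittleO
      (hone 1 (p := 1 / 4) (by norm_num))).congr (fun n => mul_one _) fun n => ?_
    rw [← Real.rpow_add_of_nonneg (by positivity) (by norm_num) (by norm_num)]
    norm_num
  have hlim' : (fun n : ℕ => c * (n : ℝ) ^ (1 / 4 : ℝ) + C) =o[Filter.atTop]
      fun n : ℕ => 2 * √(n : ℝ) := by
    refine Asymptotics.IsLittleO.const_mul_right two_ne_zero ?_
    simpa only [Real.sqrt_eq_rpow] using hlim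
  refine Asymptotics.IsBigO.trans_isLittleO (Asymptotics.IsBigO.of_bound 1 ?_) hlim'
  filter_upwards [Filter.eventually_ge_atTop 1] with n hn
  have h1 := hup n hn
  have h2 := hlow n hn
  rw [one_mul, Pi.sub_apply, Real.norm_of_nonpos (by linarith)]
  exact le_trans (by linarith) (le_abs_self _)

theorem theorem1 :
    (∃ C : ℝ, ∀ (n : ℕ), 1 ≤ n →
      ∀ (Ω : Type*) [MeasurableSpace Ω] (P : Measure Ω) [IsProbabilityMeasure P]
        (X : Fin n → Ω → ℝ), UnimodalSelection.IsIIDContinuous P X →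
        (∃ π : UnimodalSelection.FeasiblePolicy X, π.IsOptimal P) ∧
        ∀ π : UnimodalSelection.FeasiblePolicy X, π.IsOptimal P →
          π.expectedLength P < 2 * √(n : ℝ) ∧
          2 * √(n : ℝ) - 4 * √(Real.pi / 6) * (n : ℝ) ^ (1 / 4 : ℝ) - C < π.expectedLength P) ∧
    (∀ (Ω : Type*) [MeasurableSpace Ω] (P : Measure Ω) [IsProbabilityMeasure P]
        (X : ℕ → Ω → ℝ), UnimodalSelection.IsIIDContinuous P X →
        ∀ π : (n : ℕ) → UnimodalSelection.FeasiblePolicy (fun i : Fin n => X i),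
          (∀ n, 1 ≤ n → (π n).IsOptimal P) →
          Asymptotics.IsEquivalent Filter.atTop
            (fun n : ℕ => (π n).expectedLength P) (fun n : ℕ => 2 * √(n : ℝ))) := by
  -- The recursion gives coefficient 1 for n^(1/4), below the stated 4√(π/6); 11 in place of 10
  -- makes the inequality strict.
  have bounds : ∀ (n : ℕ), 1 ≤ n → UnimodalSelection.optimalValue n 0 < 2 * √(n : ℝ) ∧
      2 * √(n : ℝ) - 4 * √(Real.pi / 6) * (n : ℝ) ^ (1 / 4 : ℝ) - 11 <
        UnimodalSelection.optimalValue n 0 := by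
    intro n hn
    refine ⟨UnimodalSelection.optimalValue_lt_two_mul_sqrt hn, ?_⟩
    have h := UnimodalSelection.two_mul_sqrt_sub_le_optimalValue hn
    have hq : 0 ≤ (n : ℝ) ^ (1 / 4 : ℝ) := by positivity
    have := mul_le_mul_of_nonneg_right
      UnimodalSelection.one_le_four_mul_sqrt_pi_div_six hq
    linarith
  refine ⟨⟨11, fun n hn Ω _ P _ X hX => ⟨?_, fun π hπ => ?_⟩⟩, fun Ω _ P _ X hX π hπ => ?_⟩
  · obtain ⟨π, hπ⟩ := hX.exists_expectedLength_eq
    exact ⟨π, (hX.isOptimal_iff π).2 hπ⟩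
  · rw [(hX.isOptimal_iff π).1 hπ]
    exact bounds n hn
  · have hXn : ∀ n : ℕ, UnimodalSelection.IsIIDContinuous P fun i : Fin n => X i := fun n =>
      { measurable := fun i => hX.measurable i
        indep := hX.indep.precomp Fin.val_injective
        common_cdf := hX.common_cdf.imp fun F hF => ⟨hF.1, fun i => hF.2 i⟩ }
    have hval : ∀ n : ℕ, 1 ≤ n → (π n).expectedLength P = UnimodalSelection.optimalValue n 0 :=
      fun n hn => ((hXn n).isOptimal_iff (π n)).1 (hπ n hn)
    exact UnimodalSelection.isEquivalent_two_mul_sqrt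
      (fun n hn => (hval n hn).symm ▸ (bounds n hn).1)
      (fun n hn => (hval n hn).symm ▸ (bounds n hn).2)
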